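/- Let $n\ge 3$ be an integer. For $j\in\mathbb Z$ put $A_j=\{x\in\mathbb R^n: 2^{j-1}\le|x|<2^j\}$. For $s\in\mathbb R$ and $0<q,r\le\infty$ the homogeneous Herz space $\dot K^s_{q,r}(\mathbb R^n)$ consists of the measurable (real- or complex-valued) functions $f$ on $\mathbb R^n$ with $$\|f\|_{\dot K^s_{q,r}}=\Big(\sum_{j\in\mathbb Z}\big[2^{js}\|f\chi_{A_j}\|_{L^q}\big]^r\Big)^{1/r}<\infty$$ if $r<\infty$, and $\|f\|_{\dot K^s_{q,\infty}}=\sup_{j\in\mathbb Z}2^{js}\|f\chi_{A_j}\|_{L^q}<\infty$ if $r=\infty$. For $t>0$ let $$e^{t\Delta}g(x)=(4\pi t)^{-n/2}\int_{\mathbb R^n}e^{-|x-y|^2/(4t)}g(y)\,dy .$$ Proposition (Meyer's inequality on Herz spaces). Let $\mu,\nu\in\mathbb R$, $1\le p,q\le\infty$ and $0<r\le\infty$, with the convention $1/\infty=0$. Assume that $$\mu>\nu,\qquad 0<\frac\nu n+\frac1q<\frac\mu n+\frac1p\le1,\qquad \frac\nu n+\frac1q=\Big(\frac\mu n+\frac1p\Big)-\frac2n,$$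 and that either (1) $p,q<\infty$ and $\frac\mu n+\frac1p<1$, or (2) $r\le1$. Then there is a finite constant $C$, depending only on $n,\mu,\nu,p,q,r$, such that the following holds for all $t>0$ and all measurable $f$ on $(0,t)\times\mathbb R^n$ with $f(\tau)=f(\tau,\cdot)\in\dot K^\mu_{p,r}(\mathbb R^n)$ for every $\tau\in(0,t)$ and $\sup_{0<\tau<t}\|f(\tau)\|_{\dot K^\mu_{p,r}}<\infty$. For almost every $x\in\mathbb R^n$ the Duhamel integral $\int_0^te^{(t-\tau)\Delta}f(\tau)(x)\,d\tau$ converges absolutely (as an integral over $(0,t)\times\mathbb R^n$), it defines an element of $\dot K^\nu_{q,\infty}(\mathbb R^n)$, and $$\Big\|\int_0^te^{(t-\tau)\Delta}f(\tau)\,d\tau\Big\|_{\dot K^\nu_{q,\infty}}\le C\sup_{0<\tau<t}\|f(\tau)\|_{\dot K^\mu_{p,r}}.$$ -/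

import Mathlib

open MeasureTheory Set
open scoped ENNReal NNReal

noncomputable section

namespace Herz

variable {𝕜 : Type*} [RCLike 𝕜] {n : ℕ}

/-- The dyadic annulus `A_j = {x ∈ ℝⁿ : 2^(j-1) ≤ |x| < 2^j}`, for `j ∈ ℤ`. -/
def annulus (n : ℕ) (j : ℤ) : Set (EuclideanSpace ℝ (Fin n)) :=
  {x | (2 : ℝ) ^ (j - 1) ≤ ‖x‖ ∧ ‖x‖ < (2 : ℝ) ^ j}

/-- The dyadic piece `2^(js) ‖f χ_{A_j}‖_{L^q}`, with values in `[0, ∞]`. -/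
def piece (s : ℝ) (q : ℝ≥0∞) (f : EuclideanSpace ℝ (Fin n) → 𝕜) (j : ℤ) : ℝ≥0∞ :=
  ENNReal.ofReal ((2 : ℝ) ^ ((j : ℝ) * s)) * eLpNorm ((annulus n j).indicator f) q volume

/-- The homogeneous Herz quasi-norm of `f`, with values in `[0, ∞]`:
the `ℓ^r(ℤ)` quasi-norm of the dyadic pieces (a supremum if `r = ∞`). -/
def herzNorm (s : ℝ) (q r : ℝ≥0∞) (f : EuclideanSpace ℝ (Fin n) → 𝕜) : ℝ≥0∞ :=
  if r = ∞ then ⨆ j : ℤ, piece s q f j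
  else (∑' j : ℤ, piece s q f j ^ r.toReal) ^ (1 / r.toReal)

/-- Membership in the homogeneous Herz space: measurable (with respect to the completed
Lebesgue measure) with finite quasi-norm. -/
def MemHerz (s : ℝ) (q r : ℝ≥0∞) (f : EuclideanSpace ℝ (Fin n) → 𝕜) : Prop :=
  AEStronglyMeasurable f volume ∧ herzNorm s q r f < ∞

/-- The Gauss-Weierstrass kernel `(4πt)^(-n/2) exp(-|x|²/(4t))`. -/
def heatKernel (t : ℝ) (x : EuclideanSpace ℝ (Fin n)) : ℝ :=
  1 / Real.sqrt ((4 * Real.pi * t) ^ n) * Real.exp (-(‖x‖ ^ 2 / (4 * t)))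

/-- The heat semigroup `e^{tΔ} g(x) = ∫ heatKernel t (x - y) g(y) dy`, for `t > 0`. -/
def heatSemigroup (t : ℝ) (g : EuclideanSpace ℝ (Fin n) → 𝕜)
    (x : EuclideanSpace ℝ (Fin n)) : 𝕜 :=
  ∫ y, heatKernel t (x - y) • g y

/-- The Duhamel integral `x ↦ ∫_0^t (e^{(t-τ)Δ} f(τ))(x) dτ`. -/
def duhamel (t : ℝ) (f : ℝ → EuclideanSpace ℝ (Fin n) → 𝕜)
    (x : EuclideanSpace ℝ (Fin n)) : 𝕜 :=
  ∫ τ in (0 : ℝ)..t, heatSemigroup (t - τ) (f τ) x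

end Herz

end

/-!
The exponents `a = μ + n/p` and `b = ν + n/q` satisfy `a = b + 2`, `0 < b`, `a ≤ n`, so the claimed
inequality is scale invariant. It suffices to treat the nonnegative function `‖f‖` (`posDuhamel`),
one annulus `A_j` of the target at a time.

At a fixed time `s = t - τ`, the action of `e^{sΔ}` from `A_k` to `A_j` is of one of two kinds.

* If `|j - k| ≥ 2`, or if `s ≥ 4 ^ (j + 1)`, the kernel is at most a constant times
  `min (2 ^ (-n max j k)) (s ^ (-n/2))` (`heatKernel_le_farConst`), and only the `L¹` norm of the
  piece on `A_k` matters. Interpolating between the two terms of the minimum gives a factor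
  `2 ^ (-ε |k - j|)` with `ε = min (n - a) (b / 2)`, and a decay in time with exponent
  `κ = 1 + b / 4 > 1` (`far_exponent_le`). The sum over `k` converges because `ε > 0` when `a < n`,
  and because the pieces are summable when `r ≤ 1` (`exists_tsum_piece_le`).
* If `|j - k| ≤ 1` and `s < 4 ^ (j + 1)`, Hölder's inequality on `A_k` passes from `L^p` to
  `L^{p'}` with `p' = min p q`, and Young's inequality from `L^{p'}` to `L^q`
  (`eLpNorm_lintegral_kernel_le`), at the price of `s ^ (-σ)` with `σ = (n/2) (1/p' - 1/q)`. The
  hypothesis `ν < μ` amounts to `σ < 1` if `p ≤ q`, and `σ = 0` otherwise.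

Hence the norm on `A_j` at time `s` is bounded by `timeWeight`, the function
`min (u ^ (-σ)) (u ^ (-κ))` of `u = s / 4 ^ j` up to normalisation (`eLpNorm_posHeat_le`). As
`σ < 1 < κ`, its integral over all times is finite, and it does not depend on `j`. Minkowski's
integral inequality (`eLpNorm_lintegral_le`) concludes (`eLpNorm_posDuhamel_le`).
-/

open MeasureTheory Set
open scoped ENNReal NNReal

noncomputable section

namespace Herz

variable {n : ℕ}

/-! ### Jensen, Minkowski and Young inequalities for nonnegative functions -/

section Inequalities

variable {α β : Type*} [MeasurableSpace α] [MeasurableSpace β]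

/-- Jensen's inequality for the measure with density `w` and the power `p ≥ 1`. -/
theorem lintegral_mul_rpow_le (ρ : Measure α) {w g : α → ℝ≥0∞} (hw : Measurable w)
    (hg : Measurable g) {p : ℝ} (hp : 1 ≤ p) :
    (∫⁻ y, w y * g y ∂ρ) ^ p ≤ (∫⁻ y, w y ∂ρ) ^ (p - 1) * ∫⁻ y, w y * g y ^ p ∂ρ := by
  have hp0 : 0 < p := by linarith
  have h := eLpNorm_le_eLpNorm_mul_rpow_measure_univ (μ := ρ.withDensity w) (f := g)
    (p := 1) (q := ENNReal.ofReal p) (by simpa using hp) hg.aestronglyMeasurable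
  rw [eLpNorm_one_eq_lintegral_enorm, eLpNorm_eq_lintegral_rpow_enorm_toReal (by simpa using hp0)
    ENNReal.ofReal_ne_top, ENNReal.toReal_ofReal hp0.le] at h
  simp only [enorm_eq_self, ENNReal.toReal_one, withDensity_apply _ MeasurableSet.univ,
    Measure.restrict_univ] at h
  rw [lintegral_withDensity_eq_lintegral_mul _ hw hg,
    lintegral_withDensity_eq_lintegral_mul _ hw (hg.pow_const p)] at h
  simp only [Pi.mul_apply] at h
  calc _ ≤ _ := ENNReal.rpow_le_rpow h hp0.le
    _ = _ := by
      rw [ENNReal.mul_rpow_of_nonneg _ _ hp0.le, ← ENNReal.rpow_mul, ← ENNReal.rpow_mul, mul_comm]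
      congr 2
      · field_simp
      · rw [one_div_mul_cancel hp0.ne', ENNReal.rpow_one]

/-- Minkowski's integral inequality, in the form where a majorant `c * w s` of the norm of each
slice is known. Dividing by `w` reduces it to Jensen's inequality for the measure `w ρ`. -/
theorem eLpNorm_lintegral_le {ρ : Measure α} {π : Measure β} [SFinite ρ] [SFinite π]
    {H : α → β → ℝ≥0∞} (hH : Measurable fun z : α × β => H z.1 z.2) {w : α → ℝ≥0∞}
    (hw : Measurable w) (hw0 : ∀ᵐ s ∂ρ, w s ≠ 0) (hwt : ∀ᵐ s ∂ρ, w s ≠ ∞) {q : ℝ≥0∞} (hq : 1 ≤ q)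
    {c : ℝ≥0∞}
    (h : ∀ᵐ s ∂ρ, eLpNorm (H s) q π ≤ c * w s) :
    eLpNorm (fun x => ∫⁻ s, H s x ∂ρ) q π ≤ c * ∫⁻ s, w s ∂ρ := by
  rcases eq_or_ne q ∞ with rfl | hqt
  · rw [eLpNorm_exponent_top]
    refine essSup_le_of_ae_le _ ?_
    have h1 : ∀ᵐ s ∂ρ, ∀ᵐ x ∂π, H s x ≤ c * w s := by
      filter_upwards [h] with s hs
      rw [eLpNorm_exponent_top] at hs
      filter_upwards [enorm_ae_le_eLpNormEssSup (H s) π] with x hx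
      exact hx.trans hs
    have hm : MeasurableSet {z : α × β | H z.1 z.2 ≤ c * w z.1} :=
      measurableSet_le hH ((hw.comp measurable_fst).const_mul c)
    -- Fubini for null sets exchanges the two quantifiers
    have h2 : ∀ᵐ x ∂π, ∀ᵐ s ∂ρ, H s x ≤ c * w s := (Measure.ae_ae_comm hm).1 h1
    filter_upwards [h2] with x hx
    rw [← lintegral_const_mul _ hw]
    exact lintegral_mono_ae hx
  have hq0 : q ≠ 0 := (zero_lt_one.trans_le hq).ne'
  have hqr : 1 ≤ q.toReal := by
    rw [← ENNReal.toReal_one]; exact ENNReal.toReal_mono hqt hq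
  have hqp : 0 < q.toReal := by linarith
  rw [eLpNorm_eq_lintegral_rpow_enorm_toReal hq0 hqt, one_div, ENNReal.rpow_inv_le_iff hqp]
  simp only [enorm_eq_self]
  set Q := q.toReal
  have hHx : ∀ x, Measurable fun s => H s x := fun x =>
    hH.comp (measurable_prodMk_right (y := x))
  calc ∫⁻ x, (∫⁻ s, H s x ∂ρ) ^ Q ∂π
      ≤ ∫⁻ x, (∫⁻ s, w s ∂ρ) ^ (Q - 1) * ∫⁻ s, w s * (H s x / w s) ^ Q ∂ρ ∂π := by
        refine lintegral_mono fun x => ?_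
        refine le_trans (le_of_eq ?_) (lintegral_mul_rpow_le ρ hw ((hHx x).div hw) hqr)
        congr 1
        refine lintegral_congr_ae ?_
        filter_upwards [hw0, hwt] with s h0 ht
        exact (ENNReal.mul_div_cancel h0 ht).symm
    _ = (∫⁻ s, w s ∂ρ) ^ (Q - 1) * ∫⁻ s, ∫⁻ x, w s * (H s x / w s) ^ Q ∂π ∂ρ := by
        rw [lintegral_const_mul, lintegral_lintegral_swap]
        · exact ((hw.comp measurable_snd).mul (((hH.comp measurable_swap).div
            (hw.comp measurable_snd)).pow_const Q)).aemeasurable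
        · exact ((hw.comp measurable_snd).mul (((hH.comp measurable_swap).div
            (hw.comp measurable_snd)).pow_const Q)).lintegral_prod_right'
    _ ≤ (∫⁻ s, w s ∂ρ) ^ (Q - 1) * (c ^ Q * ∫⁻ s, w s ∂ρ) := by
        gcongr _ * ?_
        rw [← lintegral_const_mul _ hw]
        refine lintegral_mono_ae ?_
        filter_upwards [h, hw0, hwt] with s hs h0 ht
        rw [eLpNorm_eq_lintegral_rpow_enorm_toReal hq0 hqt, one_div, ENNReal.rpow_inv_le_iff hqp] at hs
        simp only [enorm_eq_self] at hs
        have hHs : Measurable (H s) := hH.comp (measurable_prodMk_left (x := s))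
        rw [lintegral_const_mul _ ((hHs.div_const _).pow_const _)]
        simp only [div_eq_mul_inv]
        simp_rw [ENNReal.mul_rpow_of_nonneg _ _ hqp.le]
        rw [lintegral_mul_const _ (hHs.pow_const _), ENNReal.inv_rpow]
        calc w s * ((∫⁻ x, H s x ^ Q ∂π) * (w s ^ Q)⁻¹) ≤
              w s * ((c * w s) ^ Q * (w s ^ Q)⁻¹) := by gcongr
          _ = c ^ Q * w s * (w s ^ Q * (w s ^ Q)⁻¹) := by
              rw [ENNReal.mul_rpow_of_nonneg _ _ hqp.le]; ring
          _ ≤ c ^ Q * w s := mul_le_of_le_one_right zero_le (ENNReal.mul_inv_le_one _)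
    _ = (c * ∫⁻ s, w s ∂ρ) ^ Q := by
        have h1 : (∫⁻ s, w s ∂ρ) ^ Q = (∫⁻ s, w s ∂ρ) ^ (Q - 1) * ∫⁻ s, w s ∂ρ := by
          conv_lhs => rw [show Q = (Q - 1) + 1 by ring]
          rw [ENNReal.rpow_add_of_nonneg _ _ (by linarith) zero_le_one, ENNReal.rpow_one]
        rw [ENNReal.mul_rpow_of_nonneg _ _ hqp.le, h1]
        ring

/-- Young's inequality for a positive kernel bounded by `B` whose marginals are at most `1`. By
Jensen, `|K F| ^ p ≤ H := K (F ^ p)`, and `H` is controlled both in `L^∞` (with constant `B`) and in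
`L¹`. -/
theorem eLpNorm_lintegral_kernel_le {ρ : Measure α} {π : Measure β} [SFinite ρ] [SFinite π]
    {K : β → α → ℝ≥0∞} (hK : Measurable fun z : β × α => K z.1 z.2) {B : ℝ≥0∞}
    (hB : ∀ x y, K x y ≤ B) (h1 : ∀ x, ∫⁻ y, K x y ∂ρ ≤ 1) (h2 : ∀ y, ∫⁻ x, K x y ∂π ≤ 1)
    {F : α → ℝ≥0∞} (hF : Measurable F) {p q : ℝ≥0∞} (hp : 1 ≤ p) (hpq : p ≤ q) :
    eLpNorm (fun x => ∫⁻ y, K x y * F y ∂ρ) q π ≤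
      B ^ ((p⁻¹).toReal - (q⁻¹).toReal) * eLpNorm F p ρ := by
  have hKx : ∀ x, Measurable (K x) := fun x =>
    hK.comp (measurable_prodMk_left (x := x))
  have hKy : ∀ y, Measurable fun x => K x y := fun y =>
    hK.comp (measurable_prodMk_right (y := y))
  rcases eq_or_ne p ∞ with rfl | hpt
  · obtain rfl : q = ∞ := top_le_iff.1 hpq
    simp only [sub_self, ENNReal.rpow_zero, one_mul, eLpNorm_exponent_top]
    refine essSup_le_of_ae_le _ (Filter.Eventually.of_forall fun x => ?_)
    calc ∫⁻ y, K x y * F y ∂ρ ≤ ∫⁻ y, K x y * eLpNormEssSup F ρ ∂ρ := by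
          refine lintegral_mono_ae ?_
          filter_upwards [enorm_ae_le_eLpNormEssSup F ρ] with y hy
          gcongr; exact hy
      _ = (∫⁻ y, K x y ∂ρ) * eLpNormEssSup F ρ := lintegral_mul_const _ (hKx x)
      _ ≤ 1 * eLpNormEssSup F ρ := by gcongr; exact h1 x
      _ = _ := one_mul _
  have hp0 : p ≠ 0 := (zero_lt_one.trans_le hp).ne'
  have hpr : 1 ≤ p.toReal := by
    rw [← ENNReal.toReal_one]; exact ENNReal.toReal_mono hpt hp
  have hpp : 0 < p.toReal := by linarith
  set N := eLpNorm F p ρ with hN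
  have hNp : ∫⁻ y, F y ^ p.toReal ∂ρ = N ^ p.toReal := by
    rw [hN, eLpNorm_eq_lintegral_rpow_enorm_toReal hp0 hpt, ← ENNReal.rpow_mul,
      one_div_mul_cancel hpp.ne', ENNReal.rpow_one]
    simp
  set H : β → ℝ≥0∞ := fun x => ∫⁻ y, K x y * F y ^ p.toReal ∂ρ with hHdef
  have hHm : Measurable H :=
    (hK.mul ((hF.pow_const p.toReal).comp measurable_snd)).lintegral_prod_right'
  have hPH : ∀ x, ∫⁻ y, K x y * F y ∂ρ ≤ H x ^ (p.toReal)⁻¹ := by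
    intro x
    rw [ENNReal.le_rpow_inv_iff hpp]
    refine (lintegral_mul_rpow_le ρ (hKx x) hF hpr).trans ?_
    calc _ ≤ 1 ^ (p.toReal - 1) * H x := by
          gcongr ?_ * _
          exact ENNReal.rpow_le_rpow (h1 x) (by linarith)
      _ = H x := by simp
  have hHB : ∀ x, H x ≤ B * N ^ p.toReal := by
    intro x
    rw [← hNp, ← lintegral_const_mul _ (hF.pow_const _)]
    exact lintegral_mono fun y => by gcongr; exact hB x y
  have hHint : ∫⁻ x, H x ∂π ≤ N ^ p.toReal := by
    rw [hHdef, lintegral_lintegral_swap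
      (hK.mul ((hF.pow_const p.toReal).comp measurable_snd)).aemeasurable, ← hNp]
    refine lintegral_mono fun y => ?_
    rw [lintegral_mul_const _ (hKy y)]
    calc _ ≤ 1 * F y ^ p.toReal := by gcongr; exact h2 y
      _ = _ := one_mul _
  rw [ENNReal.toReal_inv]
  rcases eq_or_ne q ∞ with rfl | hqt
  · rw [eLpNorm_exponent_top]
    refine essSup_le_of_ae_le _ (Filter.Eventually.of_forall fun x => ?_)
    refine (hPH x).trans ((ENNReal.rpow_le_rpow (hHB x) (by positivity)).trans (le_of_eq ?_))
    rw [ENNReal.mul_rpow_of_nonneg _ _ (by positivity), ← ENNReal.rpow_mul,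
      mul_inv_cancel₀ hpp.ne']
    simp
  have hpqr : p.toReal ≤ q.toReal := ENNReal.toReal_mono hqt hpq
  have hqp : 0 < q.toReal := by linarith
  rw [eLpNorm_eq_lintegral_rpow_enorm_toReal (hp0.bot_lt.trans_le hpq).ne' hqt,
    one_div, ENNReal.rpow_inv_le_iff hqp, ENNReal.toReal_inv]
  simp only [enorm_eq_self]
  set P := p.toReal
  set Q := q.toReal
  have hQP : 0 ≤ Q / P - 1 := by
    rw [sub_nonneg, le_div_iff₀ hpp]; linarith
  calc ∫⁻ x, (∫⁻ y, K x y * F y ∂ρ) ^ Q ∂π ≤ ∫⁻ x, (B * N ^ P) ^ (Q / P - 1) * H x ∂π := by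
        refine lintegral_mono fun x => ?_
        calc _ ≤ (H x ^ P⁻¹) ^ Q := ENNReal.rpow_le_rpow (hPH x) hqp.le
          _ = H x ^ (Q / P - 1) * H x := by
            rw [← ENNReal.rpow_mul, show P⁻¹ * Q = (Q / P - 1) + 1 by field_simp; ring,
              ENNReal.rpow_add_of_nonneg _ _ hQP zero_le_one, ENNReal.rpow_one]
          _ ≤ _ := by gcongr; exact hHB x
    _ ≤ (B * N ^ P) ^ (Q / P - 1) * N ^ P := by
        rw [lintegral_const_mul _ hHm]; gcongr
    _ = (B ^ (P⁻¹ - Q⁻¹) * N) ^ Q := by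
        rw [ENNReal.mul_rpow_of_nonneg _ _ hQP, ENNReal.mul_rpow_of_nonneg _ _ hqp.le,
          ← ENNReal.rpow_mul, ← ENNReal.rpow_mul, mul_assoc,
          ← ENNReal.rpow_add_of_nonneg _ _ (mul_nonneg hpp.le hQP) hpp.le]
        congr 2
        · field_simp
        · field_simp; ring

end Inequalities

/-! ### The heat kernel and the dyadic annuli -/

theorem heatKernel_nonneg (s : ℝ) (z : EuclideanSpace ℝ (Fin n)) : 0 ≤ heatKernel s z := by
  unfold heatKernel; positivity

theorem measurable_heatKernel : Measurable fun z : ℝ × EuclideanSpace ℝ (Fin n) => heatKernel z.1 z.2 := by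
  unfold heatKernel; fun_prop

theorem heatKernel_le_rpow {s : ℝ} (hs : 0 < s) (z : EuclideanSpace ℝ (Fin n)) :
    heatKernel s z ≤ s ^ (-(n : ℝ) / 2) := by
  have h1 : s ^ (-(n : ℝ) / 2) = 1 / Real.sqrt (s ^ n) := by
    rw [Real.sqrt_eq_rpow, ← Real.rpow_natCast, ← Real.rpow_mul hs.le, one_div,
      ← Real.rpow_neg hs.le]
    congr 1; ring
  rw [h1, heatKernel]
  have hexp : Real.exp (-(‖z‖ ^ 2 / (4 * s))) ≤ 1 := by
    rw [Real.exp_le_one_iff]; have : 0 ≤ ‖z‖ ^ 2 / (4 * s) := by positivity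
    linarith
  have h2 : Real.sqrt (s ^ n) ≤ Real.sqrt ((4 * Real.pi * s) ^ n) := by
    gcongr
    nlinarith [Real.pi_gt_three]
  calc _ ≤ 1 / Real.sqrt ((4 * Real.pi * s) ^ n) * 1 := by gcongr
    _ ≤ 1 / Real.sqrt (s ^ n) := by
      rw [mul_one]; gcongr

/-- The bound of the heat kernel at a point, uniform in time. Its square follows from
`exp (-u) ≤ n! / u ^ n` with `u = ‖z‖² / (2s)`, which keeps the exponent integral. -/
theorem heatKernel_le_norm_rpow {s : ℝ} (hs : 0 < s) {z : EuclideanSpace ℝ (Fin n)} (hz : 0 < ‖z‖) :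
    heatKernel s z ≤ Real.sqrt n.factorial * ‖z‖ ^ (-(n : ℝ)) := by
  refine le_of_sq_le_sq ?_ (by positivity)
  rw [heatKernel, mul_pow (1 / _), mul_pow (Real.sqrt _), Real.sq_sqrt (by positivity), div_pow,
    Real.sq_sqrt (by positivity), ← Real.exp_nat_mul, ← Real.rpow_natCast (_ ^ (_ : ℝ)),
    ← Real.rpow_mul hz.le]
  set u := 2 * (‖z‖ ^ 2 / (4 * s)) with hu
  have hu0 : 0 < u := by positivity
  have h1 := Real.pow_div_factorial_le_exp u hu0.le n
  have hf : (0 : ℝ) < n.factorial := by positivity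
  have h2 : Real.exp (-u) ≤ n.factorial / u ^ n := by
    rw [Real.exp_neg, inv_le_comm₀ (Real.exp_pos _) (by positivity), inv_div]
    exact h1
  have h3 : ‖z‖ ^ (-(n : ℝ) * ((2 : ℕ) : ℝ)) = 1 / (‖z‖ ^ 2) ^ n := by
    rw [← pow_mul, ← Real.rpow_natCast, one_div, ← Real.rpow_neg hz.le]
    congr 1; push_cast; ring
  rw [h3]
  have h4 : ((2 : ℕ) : ℝ) * -(‖z‖ ^ 2 / (4 * s)) = -u := by rw [hu]; push_cast; ring
  rw [h4]
  calc 1 ^ 2 / (4 * Real.pi * s) ^ n * Real.exp (-u)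
      ≤ 1 ^ 2 / (4 * Real.pi * s) ^ n * (n.factorial / u ^ n) := by gcongr
    _ = n.factorial * (1 / (2 * Real.pi * ‖z‖ ^ 2) ^ n) := by
      have h5 : 2 * Real.pi * ‖z‖ ^ 2 = (4 * Real.pi * s) * u := by rw [hu]; field_simp
      rw [h5, mul_pow (4 * Real.pi * s)]
      field_simp
    _ ≤ n.factorial * (1 / (‖z‖ ^ 2) ^ n) := by
      gcongr
      nlinarith [Real.pi_gt_three, sq_nonneg ‖z‖]

theorem lintegral_heatKernel {s : ℝ} (hs : 0 < s) :
    ∫⁻ z : EuclideanSpace ℝ (Fin n), ENNReal.ofReal (heatKernel s z) = 1 := by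
  have hint : ∫ z : EuclideanSpace ℝ (Fin n), heatKernel s z = 1 := by
    have h := GaussianFourier.integral_rexp_neg_mul_sq_norm (V := EuclideanSpace ℝ (Fin n)) (b := 1 / (4 * s))
      (by positivity)
    have h0 : ∀ z : EuclideanSpace ℝ (Fin n), heatKernel s z =
        1 / Real.sqrt ((4 * Real.pi * s) ^ n) * Real.exp (-(1 / (4 * s)) * ‖z‖ ^ 2) := by
      intro z; rw [heatKernel]; congr 2; ring
    simp_rw [h0]
    rw [integral_const_mul, h, finrank_euclideanSpace, Fintype.card_fin, Real.sqrt_eq_rpow,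
      ← Real.rpow_natCast, ← Real.rpow_mul (by positivity),
      show Real.pi / (1 / (4 * s)) = 4 * Real.pi * s by field_simp,
      show (n : ℝ) * (1 / 2) = n / 2 by ring]
    exact one_div_mul_cancel (by positivity)
  rw [← ofReal_integral_eq_lintegral_ofReal, hint, ENNReal.ofReal_one]
  · by_contra h
    rw [integral_undef h] at hint
    exact zero_ne_one hint
  · exact Filter.Eventually.of_forall fun z => heatKernel_nonneg s z

theorem measurableSet_annulus (j : ℤ) : MeasurableSet (annulus n j) :=
  (measurableSet_le measurable_const measurable_norm).inter
    (measurableSet_lt measurable_norm measurable_const)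

theorem iUnion_annulus : ⋃ j, annulus n j = {0}ᶜ := by
  ext x
  simp only [mem_iUnion, mem_compl_iff, mem_singleton_iff]
  constructor
  · rintro ⟨j, h, -⟩ rfl
    rw [norm_zero] at h
    exact absurd h (not_le.2 (by positivity))
  · intro hx
    obtain ⟨m, h1, h2⟩ := exists_mem_Ico_zpow (norm_pos_iff.2 hx) one_lt_two
    exact ⟨m + 1, by simpa using h1, h2⟩

theorem pairwise_disjoint_annulus : Pairwise (Function.onFun Disjoint (annulus n)) := by
  intro i j hij
  rw [Function.onFun, Set.disjoint_left]
  rintro x ⟨h1, h2⟩ ⟨h3, h4⟩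
  have h5 := (zpow_lt_zpow_iff_right₀ (one_lt_two (α := ℝ))).1 (h1.trans_lt h4)
  have h6 := (zpow_lt_zpow_iff_right₀ (one_lt_two (α := ℝ))).1 (h3.trans_lt h2)
  omega

theorem volume_annulus_le (j : ℤ) :
    volume (annulus n j) ≤
      ENNReal.ofReal ((2 : ℝ) ^ ((j : ℝ) * n)) * volume (Metric.ball (0 : EuclideanSpace ℝ (Fin n)) 1) := by
  have h : annulus n j ⊆ Metric.ball (0 : EuclideanSpace ℝ (Fin n)) ((2 : ℝ) ^ j) := by
    rintro x ⟨-, h⟩; simpa using h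
  refine (measure_mono h).trans (le_of_eq ?_)
  rw [Measure.addHaar_ball_of_pos _ _ (by positivity), finrank_euclideanSpace, Fintype.card_fin,
    Real.rpow_mul zero_le_two, Real.rpow_intCast, Real.rpow_natCast]

/-! ### The weight in time and the off-diagonal kernel bound -/

/-- The power `2 ^ x`, for a real exponent `x`, as an extended nonnegative real. -/
def twoPow (x : ℝ) : ℝ≥0∞ := ENNReal.ofReal ((2 : ℝ) ^ x)

theorem twoPow_add (x y : ℝ) : twoPow (x + y) = twoPow x * twoPow y := by
  rw [twoPow, Real.rpow_add two_pos, ENNReal.ofReal_mul (by positivity)]; rfl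

theorem twoPow_zero : twoPow 0 = 1 := by simp [twoPow]

theorem twoPow_mono {x y : ℝ} (h : x ≤ y) : twoPow x ≤ twoPow y :=
  ENNReal.ofReal_le_ofReal (Real.rpow_le_rpow_of_exponent_le one_le_two h)

theorem twoPow_ne_top (x : ℝ) : twoPow x ≠ ∞ := ENNReal.ofReal_ne_top

theorem twoPow_rpow (x y : ℝ) : twoPow x ^ y = twoPow (x * y) := by
  rw [twoPow, ENNReal.ofReal_rpow_of_pos (by positivity), ← Real.rpow_mul zero_le_two]; rfl

theorem twoPow_neg_mul_cancel (x : ℝ) (c : ℝ≥0∞) : twoPow (-x) * (twoPow x * c) = c := by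
  rw [← mul_assoc, ← twoPow_add, neg_add_cancel, twoPow_zero, one_mul]

/-- The profile `min (u ^ (-σ)) (u ^ (-κ))`, integrable on `(0, ∞)` when `σ < 1 < κ`. -/
def timeProfile (σ κ u : ℝ) : ℝ := min (u ^ (-σ)) (u ^ (-κ))

theorem timeProfile_nonneg (σ κ : ℝ) {u : ℝ} (hu : 0 ≤ u) : 0 ≤ timeProfile σ κ u :=
  le_min (Real.rpow_nonneg hu _) (Real.rpow_nonneg hu _)

/-- The profile at the parabolic scale `4 ^ j`, normalised so that its integral over `(0, ∞)` does
not depend on `j`. -/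
def timeWeight (σ κ : ℝ) (j : ℤ) (s : ℝ) : ℝ≥0∞ :=
  ENNReal.ofReal ((2 : ℝ) ^ (-2 * (j : ℝ)) * timeProfile σ κ ((2 : ℝ) ^ (-2 * (j : ℝ)) * s))

theorem measurable_timeProfile (σ κ : ℝ) : Measurable (timeProfile σ κ) := by
  unfold timeProfile; fun_prop

theorem measurable_timeWeight (σ κ : ℝ) (j : ℤ) : Measurable (timeWeight σ κ j) := by
  unfold timeWeight
  exact (((measurable_timeProfile σ κ).comp (measurable_const_mul _)).const_mul _).ennreal_ofReal

theorem timeWeight_ne_top (σ κ : ℝ) (j : ℤ) (s : ℝ) : timeWeight σ κ j s ≠ ∞ :=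
  ENNReal.ofReal_ne_top

theorem timeWeight_ne_zero (σ κ : ℝ) (j : ℤ) {s : ℝ} (hs : 0 < s) : timeWeight σ κ j s ≠ 0 := by
  rw [timeWeight, ENNReal.ofReal_ne_zero_iff]
  unfold timeProfile
  have : 0 < (2 : ℝ) ^ (-2 * (j : ℝ)) * s := by positivity
  exact mul_pos (by positivity) (lt_min (Real.rpow_pos_of_pos this _) (Real.rpow_pos_of_pos this _))

/-- A lower bound for the weight at time `4 ^ l`, in terms of exponents. -/
theorem twoPow_le_timeWeight {σ κ e l : ℝ} {j : ℤ} (h1 : e ≤ -2 * j - 2 * σ * (l - j))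
    (h2 : e ≤ -2 * j - 2 * κ * (l - j)) : twoPow e ≤ timeWeight σ κ j ((2 : ℝ) ^ (2 * l)) := by
  refine ENNReal.ofReal_le_ofReal ?_
  have h : ∀ τ : ℝ, (2 : ℝ) ^ (-2 * (j : ℝ)) *
      ((2 : ℝ) ^ (-2 * (j : ℝ)) * (2 : ℝ) ^ (2 * l)) ^ (-τ) =
        (2 : ℝ) ^ (-2 * j - 2 * τ * (l - j)) := by
    intro τ
    rw [← Real.rpow_add two_pos, ← Real.rpow_mul zero_le_two, ← Real.rpow_add two_pos]
    congr 1; ring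
  rw [timeProfile, mul_min_of_nonneg _ _ (by positivity), h, h]
  exact le_min (Real.rpow_le_rpow_of_exponent_le one_le_two h1)
    (Real.rpow_le_rpow_of_exponent_le one_le_two h2)

theorem integrableOn_timeProfile {σ κ : ℝ} (hσ : σ < 1) (hκ : 1 < κ) :
    IntegrableOn (timeProfile σ κ) (Ioi 0) := by
  rw [← Ioc_union_Ioi_eq_Ioi (zero_le_one (α := ℝ))]
  refine IntegrableOn.union ?_ ?_
  · have h : IntegrableOn (fun u : ℝ => u ^ (-σ)) (Ioc 0 1) :=
      (intervalIntegrable_iff_integrableOn_Ioc_of_le zero_le_one).1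
        (intervalIntegral.intervalIntegrable_rpow' (by linarith))
    refine h.mono' (measurable_timeProfile σ κ).aestronglyMeasurable ?_
    refine (ae_restrict_iff' measurableSet_Ioc).2 (Filter.Eventually.of_forall fun u hu => ?_)
    rw [Real.norm_of_nonneg (timeProfile_nonneg σ κ hu.1.le)]
    exact min_le_left _ _
  · have h : IntegrableOn (fun u : ℝ => u ^ (-κ)) (Ioi 1) :=
      integrableOn_Ioi_rpow_of_lt (by linarith) one_pos
    refine h.mono' (measurable_timeProfile σ κ).aestronglyMeasurable ?_
    refine (ae_restrict_iff' measurableSet_Ioi).2 (Filter.Eventually.of_forall fun u hu => ?_)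
    have hu0 : (0 : ℝ) ≤ u := zero_le_one.trans (le_of_lt hu)
    rw [Real.norm_of_nonneg (timeProfile_nonneg σ κ hu0)]
    exact min_le_right _ _

theorem lintegral_timeWeight {σ κ : ℝ} (hσ : σ < 1) (hκ : 1 < κ) (j : ℤ) :
    ∫⁻ s in Ioi (0 : ℝ), timeWeight σ κ j s =
      ENNReal.ofReal (∫ u in Ioi (0 : ℝ), timeProfile σ κ u) := by
  have hc : (0 : ℝ) < (2 : ℝ) ^ (-2 * (j : ℝ)) := by positivity
  have hint : IntegrableOn (fun s => timeProfile σ κ ((2 : ℝ) ^ (-2 * (j : ℝ)) * s)) (Ioi 0) := by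
    rw [integrableOn_Ioi_comp_mul_left_iff _ _ hc, mul_zero]
    exact integrableOn_timeProfile hσ hκ
  unfold timeWeight
  rw [← ofReal_integral_eq_lintegral_ofReal (hint.const_mul _), integral_const_mul,
    integral_comp_mul_left_Ioi _ _ hc, mul_zero, smul_eq_mul, mul_inv_cancel_left₀ hc.ne']
  refine (ae_restrict_iff' measurableSet_Ioi).2 (Filter.Eventually.of_forall fun u hu => ?_)
  have : 0 ≤ (2 : ℝ) ^ (-2 * (j : ℝ)) * u := mul_nonneg hc.le (le_of_lt hu)
  exact mul_nonneg hc.le (timeProfile_nonneg σ κ this)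

/-- The exponent bookkeeping of the off-diagonal part: `j`, `k` are the scales of target and source,
`4 ^ l` is the time, and `N` is the dimension. The kernel bound, times the norm growth from `L^p` to
`L¹`, leaves decay both in `|k - j|` and in the time beyond `4 ^ j`. -/
theorem far_exponent_le {N a b j k l : ℝ} (hb : 0 < b) (hab : a = b + 2) (haN : a ≤ N) :
    -N * max (max j k) l + k * (N - a) ≤
      -j * a - (2 + b / 2) * max 0 (l - j) - min (N - a) (b / 2) * |k - j| := by
  have hM1 : j ≤ max (max j k) l := (le_max_left _ _).trans (le_max_left _ _)
  have hM2 : k ≤ max (max j k) l := (le_max_right _ _).trans (le_max_left _ _)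
  have hM3 : l ≤ max (max j k) l := le_max_right _ _
  have hL : max 0 (l - j) ≤ max (max j k) l - j := max_le (by linarith) (by linarith)
  have hL0 : 0 ≤ max 0 (l - j) := le_max_left _ _
  have he1 := min_le_left (N - a) (b / 2)
  have he2 := min_le_right (N - a) (b / 2)
  set M := max (max j k) l
  set L := max 0 (l - j)
  set ε := min (N - a) (b / 2)
  have h1 : (2 + b / 2) * L ≤ (2 + b / 2) * (M - j) := by gcongr
  -- for `k ≥ j`, a part `2 + b / 2` of the factor `N` is spent on time, the rest on `k - j`
  rcases le_total k j with h | h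
  · rw [abs_of_nonpos (by linarith)]
    have h2 : 0 ≤ (N - 2 - b / 2) * (M - j) := mul_nonneg (by linarith) (by linarith)
    have h3 : ε * (j - k) ≤ (N - a) * (j - k) := by gcongr
    nlinarith
  · rw [abs_of_nonneg (by linarith)]
    have h2 : (N - 2 - b / 2) * (k - j) ≤ (N - 2 - b / 2) * (M - j) := by
      gcongr; linarith
    have h3 : ε * (k - j) ≤ b / 2 * (k - j) := by gcongr
    subst hab
    nlinarith

theorem norm_sub_ge_of_annulus {j k : ℤ} (hjk : 2 ≤ |j - k|) {x y : EuclideanSpace ℝ (Fin n)}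
    (hx : x ∈ annulus n j) (hy : y ∈ annulus n k) : (2 : ℝ) ^ (max j k - 2) ≤ ‖x - y‖ := by
  have key : ∀ {j k : ℤ} {x y : EuclideanSpace ℝ (Fin n)}, j + 2 ≤ k → x ∈ annulus n j →
      y ∈ annulus n k → (2 : ℝ) ^ (k - 2) ≤ ‖x - y‖ := by
    intro j k x y h hx hy
    have h1 : ‖x‖ ≤ (2 : ℝ) ^ (k - 2) :=
      hx.2.le.trans (zpow_le_zpow_right₀ one_le_two (by omega))
    have h2 : (2 : ℝ) ^ (k - 1) = 2 * (2 : ℝ) ^ (k - 2) := by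
      rw [← zpow_one_add₀ two_ne_zero]; congr 1; ring
    have h3 := hy.1
    have h4 := norm_sub_norm_le y x
    rw [norm_sub_rev] at h4
    linarith
  rcases le_abs.1 hjk with h | h
  · rw [max_eq_left (by omega), norm_sub_rev]
    exact key (by omega) hy hx
  · rw [max_eq_right (by omega)]
    exact key (by omega) hx hy

theorem heatKernel_le_twoPow (l : ℝ) (z : EuclideanSpace ℝ (Fin n)) :
    ENNReal.ofReal (heatKernel ((2 : ℝ) ^ (2 * l)) z) ≤ twoPow (-n * l) := by
  refine ENNReal.ofReal_le_ofReal ((heatKernel_le_rpow (by positivity) z).trans (le_of_eq ?_))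
  rw [← Real.rpow_mul zero_le_two]
  congr 1; ring

/-- The constant in the off-diagonal bound for the heat kernel. -/
def farConst (n : ℕ) : ℝ≥0∞ := ENNReal.ofReal (Real.sqrt n.factorial) * twoPow (2 * n)

theorem one_le_farConst (n : ℕ) : 1 ≤ farConst n := by
  have h1 : (1 : ℝ≥0∞) ≤ ENNReal.ofReal (Real.sqrt n.factorial) := by
    rw [ENNReal.one_le_ofReal, Real.one_le_sqrt]
    exact_mod_cast n.factorial_pos
  have h2 : (1 : ℝ≥0∞) ≤ twoPow (2 * n) := by
    rw [← twoPow_zero]; exact twoPow_mono (by positivity)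
  exact one_le_mul h1 h2

/-- Off the parabolic diagonal, that is for annuli that do not touch or for late times, the heat
kernel at time `4 ^ l` is of size at most `2 ^ (-n m)`, where `m` is the largest of the three
dyadic scales involved. -/
theorem heatKernel_le_farConst {j k : ℤ} {l : ℝ} (h : 2 ≤ |j - k| ∨ (j : ℝ) + 1 ≤ l)
    {x y : EuclideanSpace ℝ (Fin n)} (hx : x ∈ annulus n j) (hy : y ∈ annulus n k) :
    ENNReal.ofReal (heatKernel ((2 : ℝ) ^ (2 * l)) (x - y)) ≤
      farConst n * twoPow (-n * max (max (j : ℝ) k) l) := by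
  have hl := heatKernel_le_twoPow l (x - y)
  -- if time is the largest scale, the bound of the kernel at the origin suffices
  by_cases hml : max (j : ℝ) k ≤ l
  · rw [max_eq_right hml]
    exact hl.trans (le_mul_of_one_le_left zero_le (one_le_farConst n))
  have hjk : 2 ≤ |j - k| := by
    rcases h with h | h
    · exact h
    · have h1 : l < k := by
        rcases lt_max_iff.1 (not_le.1 hml) with h2 | h2
        · linarith
        · exact h2
      have h2 : j + 1 < k := by
        have : (j : ℝ) + 1 < k := h.trans_lt h1
        exact_mod_cast this
      rw [abs_sub_comm]
      exact (by omega : 2 ≤ k - j).trans (le_abs_self _)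
  rw [max_eq_left (not_le.1 hml).le]
  have hz := norm_sub_ge_of_annulus hjk hx hy
  have hz0 : 0 < ‖x - y‖ := lt_of_lt_of_le (by positivity) hz
  rw [farConst, mul_assoc, ← twoPow_add, twoPow, ← ENNReal.ofReal_mul (by positivity)]
  refine ENNReal.ofReal_le_ofReal
    ((heatKernel_le_norm_rpow (by positivity) hz0).trans ?_)
  gcongr
  calc ‖x - y‖ ^ (-(n : ℝ)) ≤ ((2 : ℝ) ^ (max j k - 2)) ^ (-(n : ℝ)) :=
        Real.rpow_le_rpow_of_nonpos (by positivity) hz (by simp)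
    _ = _ := by
      rw [← Real.rpow_intCast, ← Real.rpow_mul zero_le_two]
      congr 1; push_cast; ring

/-! ### The fixed-time estimate -/

/-- The maximum of `1` and the volume of the unit ball; it dominates every power of that volume with
exponent in `[0, 1]`. -/
def ballConst (n : ℕ) : ℝ≥0∞ := max 1 (volume (Metric.ball (0 : EuclideanSpace ℝ (Fin n)) 1))

theorem ballConst_ne_top (n : ℕ) : ballConst n ≠ ∞ :=
  (max_lt ENNReal.one_lt_top measure_ball_lt_top).ne

theorem volume_annulus_rpow_le (k : ℤ) {θ : ℝ} (h0 : 0 ≤ θ) (h1 : θ ≤ 1) :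
    volume (annulus n k) ^ θ ≤ ballConst n * twoPow (k * n * θ) := by
  calc volume (annulus n k) ^ θ ≤ (twoPow (k * n) * ballConst n) ^ θ := by
        refine ENNReal.rpow_le_rpow ((volume_annulus_le k).trans ?_) h0
        gcongr
        · exact le_rfl
        · exact le_max_right _ _
    _ = ballConst n ^ θ * twoPow (k * n * θ) := by
        rw [ENNReal.mul_rpow_of_nonneg _ _ h0, twoPow_rpow, mul_comm]
    _ ≤ ballConst n * twoPow (k * n * θ) := by
        gcongr
        calc ballConst n ^ θ ≤ ballConst n ^ (1 : ℝ) :=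
              ENNReal.rpow_le_rpow_of_exponent_le (le_max_left _ _) h1
          _ = _ := ENNReal.rpow_one _

theorem toReal_inv_le_one {p : ℝ≥0∞} (hp : 1 ≤ p) : (p⁻¹).toReal ≤ 1 := by
  rw [← ENNReal.toReal_one]
  exact ENNReal.toReal_mono ENNReal.one_ne_top (ENNReal.inv_le_one.2 hp)

theorem toReal_inv_le_toReal_inv {p q : ℝ≥0∞} (hp : 1 ≤ p) (hpq : p ≤ q) :
    (q⁻¹).toReal ≤ (p⁻¹).toReal :=
  ENNReal.toReal_mono (ENNReal.inv_ne_top.2 (zero_lt_one.trans_le hp).ne')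
    (ENNReal.inv_le_inv.2 hpq)

/-- Hölder's inequality on an annulus. -/
theorem eLpNorm_annulus_le {p₁ p₂ : ℝ≥0∞} (h1 : 1 ≤ p₁) (h : p₁ ≤ p₂) (k : ℤ)
    {F : EuclideanSpace ℝ (Fin n) → ℝ≥0∞} (hF : Measurable F) :
    eLpNorm F p₁ (volume.restrict (annulus n k)) ≤
      ballConst n * twoPow (k * n * ((p₁⁻¹).toReal - (p₂⁻¹).toReal)) *
        eLpNorm F p₂ (volume.restrict (annulus n k)) := by
  refine (eLpNorm_le_eLpNorm_mul_rpow_measure_univ h hF.aestronglyMeasurable).trans ?_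
  rw [mul_comm, Measure.restrict_apply_univ, one_div, one_div, ← ENNReal.toReal_inv,
    ← ENNReal.toReal_inv]
  gcongr
  have ha := toReal_inv_le_one h1
  have hb : 0 ≤ (p₂⁻¹).toReal := ENNReal.toReal_nonneg
  exact volume_annulus_rpow_le k (sub_nonneg.2 (toReal_inv_le_toReal_inv h1 h)) (by linarith)

theorem tsum_ite_near_eq (j : ℤ) (g : ℤ → ℝ≥0∞) :
    ∑' k : ℤ, (if |j - k| ≤ 1 then g k else 0) = ∑ k ∈ Finset.Icc (j - 1) (j + 1), g k := by
  rw [tsum_eq_sum (s := Finset.Icc (j - 1) (j + 1))]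
  · refine Finset.sum_congr rfl fun k hk => if_pos ?_
    rw [Finset.mem_Icc] at hk
    rw [abs_le]; omega
  · intro k hk
    rw [if_neg]
    rw [Finset.mem_Icc] at hk
    rw [abs_le]; omega

section FixedTime

/-- The heat semigroup acting on nonnegative functions. -/
def posHeat (s : ℝ) (F : EuclideanSpace ℝ (Fin n) → ℝ≥0∞) (x : EuclideanSpace ℝ (Fin n)) : ℝ≥0∞ :=
  ∫⁻ y, ENNReal.ofReal (heatKernel s (x - y)) * F y

theorem measurable_ofReal_heatKernel_sub (s : ℝ) :
    Measurable fun z : EuclideanSpace ℝ (Fin n) × EuclideanSpace ℝ (Fin n) =>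
      ENNReal.ofReal (heatKernel s (z.1 - z.2)) :=
  (measurable_heatKernel.comp
    (measurable_const.prodMk (measurable_fst.sub measurable_snd))).ennreal_ofReal

theorem posHeat_eq_tsum (hn : n ≠ 0) (s : ℝ) (F : EuclideanSpace ℝ (Fin n) → ℝ≥0∞)
    (x : EuclideanSpace ℝ (Fin n)) :
    posHeat s F x = ∑' k : ℤ, ∫⁻ y in annulus n k, ENNReal.ofReal (heatKernel s (x - y)) * F y := by
  have : NeZero n := ⟨hn⟩
  rw [posHeat, ← lintegral_iUnion measurableSet_annulus pairwise_disjoint_annulus, iUnion_annulus,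
    restrict_compl_singleton]

/-- On the annulus `A_j`, at time `4 ^ l`, the interaction with `A_k` is either controlled by the
`L¹` norm on `A_k`, or is a local interaction at a short time. -/
theorem posHeat_le (hn : n ≠ 0) (l : ℝ) {j : ℤ} {F : EuclideanSpace ℝ (Fin n) → ℝ≥0∞}
    (hF : Measurable F) {x : EuclideanSpace ℝ (Fin n)} (hx : x ∈ annulus n j) :
    posHeat ((2 : ℝ) ^ (2 * l)) F x ≤
      ∑' k : ℤ, farConst n * twoPow (-n * max (max (j : ℝ) k) l) *
        eLpNorm F 1 (volume.restrict (annulus n k)) +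
      if l < j + 1 then ∑ k ∈ Finset.Icc (j - 1) (j + 1), ∫⁻ y in annulus n k,
        ENNReal.ofReal (heatKernel ((2 : ℝ) ^ (2 * l)) (x - y)) * F y else 0 := by
  have hfar : ∀ k : ℤ, 2 ≤ |j - k| ∨ (j : ℝ) + 1 ≤ l →
      ∫⁻ y in annulus n k, ENNReal.ofReal (heatKernel ((2 : ℝ) ^ (2 * l)) (x - y)) * F y ≤
        farConst n * twoPow (-n * max (max (j : ℝ) k) l) *
          eLpNorm F 1 (volume.restrict (annulus n k)) := by
    intro k hk
    rw [eLpNorm_one_eq_lintegral_enorm]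
    simp only [enorm_eq_self]
    rw [← lintegral_const_mul _ hF]
    refine setLIntegral_mono' (measurableSet_annulus k) fun y hy => ?_
    gcongr
    exact heatKernel_le_farConst hk hx hy
  rw [posHeat_eq_tsum hn]
  split_ifs with hl
  · rw [← tsum_ite_near_eq, ← ENNReal.tsum_add]
    refine ENNReal.tsum_le_tsum fun k => ?_
    split_ifs with hk
    · exact le_add_self
    · rw [add_zero]; exact hfar k (Or.inl (by omega))
  · rw [add_zero]
    exact ENNReal.tsum_le_tsum fun k => hfar k (Or.inr (not_lt.1 hl))

/-- The `L^{p'} → L^q` smoothing estimate between two annuli. -/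
theorem eLpNorm_near_le (l : ℝ) (j k : ℤ) {F : EuclideanSpace ℝ (Fin n) → ℝ≥0∞}
    (hF : Measurable F) {p' q : ℝ≥0∞} (hp' : 1 ≤ p') (hq : p' ≤ q) :
    eLpNorm (fun x => ∫⁻ y in annulus n k,
        ENNReal.ofReal (heatKernel ((2 : ℝ) ^ (2 * l)) (x - y)) * F y) q
        (volume.restrict (annulus n j)) ≤
      twoPow (-n * l * ((p'⁻¹).toReal - (q⁻¹).toReal)) *
        eLpNorm F p' (volume.restrict (annulus n k)) := by
  have hs : (0 : ℝ) < (2 : ℝ) ^ (2 * l) := by positivity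
  rw [← twoPow_rpow]
  refine eLpNorm_lintegral_kernel_le (measurable_ofReal_heatKernel_sub _)
    (fun x y => heatKernel_le_twoPow l (x - y)) (fun x => ?_) (fun y => ?_) hF hp' hq
  · refine (setLIntegral_le_lintegral _ _).trans (le_of_eq ?_)
    rw [lintegral_sub_left_eq_self
      (fun z : EuclideanSpace ℝ (Fin n) => ENNReal.ofReal (heatKernel ((2 : ℝ) ^ (2 * l)) z)),
      lintegral_heatKernel hs]
  · refine (setLIntegral_le_lintegral _ _).trans (le_of_eq ?_)
    rw [lintegral_sub_right_eq_self
      (fun z : EuclideanSpace ℝ (Fin n) => ENNReal.ofReal (heatKernel ((2 : ℝ) ^ (2 * l)) z)),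
      lintegral_heatKernel hs]

variable {μ ν a b : ℝ} {p p' q : ℝ≥0∞}

/-- The off-diagonal part of the fixed-time estimate: the sum is a pointwise bound on `A_j`, so its
`L^q` norm there costs a power of the volume of `A_j`. The exponents are `a = μ + n/p` and
`b = ν + n/q`. -/
theorem far_sum_le (hp : 1 ≤ p) (hq : 1 ≤ q) (ha : a = μ + n * (p⁻¹).toReal)
    (hbdef : b = ν + n * (q⁻¹).toReal) (hb : 0 < b) (hab : a = b + 2) (han : a ≤ n)
    {σ : ℝ} (hσ0 : 0 ≤ σ) (hσ1 : σ < 1) (j : ℤ) (l : ℝ)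
    {F : EuclideanSpace ℝ (Fin n) → ℝ≥0∞} (hF : Measurable F) :
    twoPow (j * ν) * ((∑' k : ℤ, farConst n * twoPow (-n * max (max (j : ℝ) k) l) *
        eLpNorm F 1 (volume.restrict (annulus n k))) *
          volume (annulus n j) ^ (q⁻¹).toReal) ≤
      ballConst n * ballConst n * farConst n * timeWeight σ (1 + b / 4) j ((2 : ℝ) ^ (2 * l)) *
        ∑' k : ℤ, twoPow (-min (n - a) (b / 2) * |(k : ℝ) - j|) *
          (twoPow (k * μ) * eLpNorm F p (volume.restrict (annulus n k))) := by
  rw [← ENNReal.tsum_mul_right, ← ENNReal.tsum_mul_left, ← ENNReal.tsum_mul_left]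
  refine ENNReal.tsum_le_tsum fun k => ?_
  set L := eLpNorm F p (volume.restrict (annulus n k)) with hL
  set W := timeWeight σ (1 + b / 4) j ((2 : ℝ) ^ (2 * l)) with hW
  have h1 := eLpNorm_annulus_le le_rfl hp k hF
  rw [inv_one, ENNReal.toReal_one] at h1
  have h2 := volume_annulus_rpow_le (n := n) j (ENNReal.toReal_nonneg (a := q⁻¹))
    (toReal_inv_le_one hq)
  have hexp := far_exponent_le (N := n) (j := j) (k := k) (l := l) hb hab han
  set X := max (max (j : ℝ) k) l
  set ε := min ((n : ℝ) - a) (b / 2)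
  have hx0 : 0 ≤ max 0 (l - j) := le_max_left _ _
  have hx1 : l - j ≤ max 0 (l - j) := le_max_right _ _
  set x := max 0 (l - (j : ℝ))
  have hw : twoPow (-2 * j - (2 + b / 2) * x) ≤ W := by
    refine twoPow_le_timeWeight ?_ ?_
    · have : σ * (l - j) ≤ (1 + b / 4) * x := by
        calc σ * (l - j) ≤ σ * x := by gcongr
          _ ≤ (1 + b / 4) * x := by gcongr; linarith
      linarith
    · have : (1 + b / 4) * (l - j) ≤ (1 + b / 4) * x := by gcongr
      linarith
  calc twoPow (j * ν) * (farConst n * twoPow (-n * X) *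
        eLpNorm F 1 (volume.restrict (annulus n k)) * volume (annulus n j) ^ (q⁻¹).toReal)
      ≤ twoPow (j * ν) * (farConst n * twoPow (-n * X) *
        (ballConst n * twoPow (k * n * (1 - (p⁻¹).toReal)) * L) *
        (ballConst n * twoPow (j * n * (q⁻¹).toReal))) := by gcongr
    _ = ballConst n * ballConst n * farConst n * ((twoPow (j * ν) * twoPow (-n * X) *
        twoPow (k * n * (1 - (p⁻¹).toReal)) * twoPow (j * n * (q⁻¹).toReal)) * L) := by ring
    _ ≤ ballConst n * ballConst n * farConst n * ((W * twoPow (-ε * |(k : ℝ) - j|) *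
          twoPow (k * μ)) * L) := by
        gcongr ballConst n * ballConst n * farConst n * (?_ * L)
        calc _ ≤ twoPow (-2 * j - (2 + b / 2) * x) * twoPow (-ε * |(k : ℝ) - j|) *
              twoPow (k * μ) := by
              simp only [← twoPow_add]
              refine twoPow_mono ?_
              have e1 : (k : ℝ) * n * (1 - (p⁻¹).toReal) = k * (n - a) + k * μ := by
                rw [ha]; ring
              have e2 : (j : ℝ) * ν + j * n * (q⁻¹).toReal = j * b := by rw [hbdef]; ring
              have e3 : (j : ℝ) * a = j * b + 2 * j := by rw [hab]; ring
              linarith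
          _ ≤ _ := by gcongr
    _ = _ := by ring

/-- The diagonal part of the fixed-time estimate: neighbouring annuli at times `s < 4 ^ (j + 1)`. -/
theorem near_le (hp' : 1 ≤ p') (hp'p : p' ≤ p) (hp'q : p' ≤ q)
    (ha : a = μ + n * (p⁻¹).toReal) (hbdef : b = ν + n * (q⁻¹).toReal) (hb : 0 < b)
    (hab : a = b + 2) {σ : ℝ} (hσ : 2 * σ = n * ((p'⁻¹).toReal - (q⁻¹).toReal)) (hσ1 : σ < 1)
    {j k : ℤ} (hk : k ∈ Finset.Icc (j - 1) (j + 1)) {l : ℝ} (hl : l < j + 1)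
    {F : EuclideanSpace ℝ (Fin n) → ℝ≥0∞} (hF : Measurable F) :
    twoPow (j * ν) * eLpNorm (fun x => ∫⁻ y in annulus n k,
        ENNReal.ofReal (heatKernel ((2 : ℝ) ^ (2 * l)) (x - y)) * F y) q
        (volume.restrict (annulus n j)) ≤
      ballConst n * twoPow (n + |μ| + 2 + b / 2) *
        timeWeight σ (1 + b / 4) j ((2 : ℝ) ^ (2 * l)) *
          (twoPow (k * μ) * eLpNorm F p (volume.restrict (annulus n k))) := by
  have h1 := eLpNorm_near_le l j k hF hp' hp'q
  have h2 := eLpNorm_annulus_le hp' hp'p k hF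
  set L := eLpNorm F p (volume.restrict (annulus n k))
  set W := timeWeight σ (1 + b / 4) j ((2 : ℝ) ^ (2 * l))
  have i1 := toReal_inv_le_one hp'
  have i2 := toReal_inv_le_toReal_inv hp' hp'p
  have i3 : 0 ≤ (p⁻¹).toReal := ENNReal.toReal_nonneg
  set P := (p⁻¹).toReal
  set P' := (p'⁻¹).toReal
  set R := (q⁻¹).toReal
  calc twoPow (j * ν) * _ ≤ twoPow (j * ν) * (twoPow (-n * l * (P' - R)) *
        (ballConst n * twoPow (k * n * (P' - P)) * L)) := by gcongr; exact h1.trans (by gcongr)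
    _ = ballConst n * ((twoPow (j * ν) * twoPow (-n * l * (P' - R)) * twoPow (k * n * (P' - P)))
          * L) := by ring
    _ ≤ ballConst n * ((twoPow (n + |μ| + 2 + b / 2) * W * twoPow (k * μ)) * L) := by
        gcongr ballConst n * (?_ * L)
        calc _ ≤ twoPow (n + |μ| + 2 + b / 2) *
              twoPow (-2 * j - 2 * σ * (l - j) - (2 + b / 2)) * twoPow (k * μ) := by
              simp only [← twoPow_add]
              refine twoPow_mono ?_
              rw [Finset.mem_Icc] at hk
              have k1 : (j : ℝ) - 1 ≤ k := by exact_mod_cast hk.1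
              have k2 : (k : ℝ) ≤ j + 1 := by exact_mod_cast hk.2
              have e1 : -(n : ℝ) * l * (P' - R) = -2 * σ * l := by
                linear_combination (-l) * -hσ
              have e2 : (j : ℝ) * ν + k * n * (P' - P) =
                  -2 * j + 2 * σ * j + k * μ + (k - j) * (n * (P' - P) - μ) := by
                linear_combination (-j : ℝ) * hσ - (j : ℝ) * hbdef + j * ha - j * hab
              have e3 : ((k : ℝ) - j) * (n * (P' - P) - μ) ≤ n + |μ| := by
                have : |n * (P' - P) - μ| ≤ n + |μ| := by
                  refine (abs_sub _ _).trans ?_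
                  gcongr
                  rw [abs_of_nonneg (mul_nonneg (by positivity) (by linarith))]
                  calc (n : ℝ) * (P' - P) ≤ n * 1 := by gcongr; linarith
                    _ = n := mul_one _
                calc _ ≤ |((k : ℝ) - j) * (n * (P' - P) - μ)| := le_abs_self _
                  _ = |(k : ℝ) - j| * |n * (P' - P) - μ| := abs_mul _ _
                  _ ≤ 1 * (n + |μ|) := by
                    gcongr
                    rw [abs_le]; constructor <;> linarith
                  _ = _ := one_mul _
              linarith
          _ ≤ _ := by
              gcongr
              -- `u ^ (-σ)` is comparable to the profile as long as `u < 4`, that is `l - j < 1`;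
              -- this costs the factor `2 ^ (2 + b / 2)`
              refine twoPow_le_timeWeight (by linarith) ?_
              have : (1 + b / 4 - σ) * (l - j) ≤ (1 + b / 4 - σ) * 1 := by
                gcongr <;> linarith
              have hσ0 : 0 ≤ σ := by
                have := toReal_inv_le_toReal_inv hp' hp'q
                have : 0 ≤ (n : ℝ) * (P' - R) := mul_nonneg (by positivity) (sub_nonneg.2 this)
                linarith
              linarith
    _ = _ := by ring

/-- The constant in the fixed-time estimate: the off-diagonal part, where `S` bounds the weighted sum
of the dyadic pieces, plus three neighbouring annuli. -/
def heatConst (n : ℕ) (μ b : ℝ) (S : ℝ≥0∞) : ℝ≥0∞ :=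
  ballConst n * ballConst n * farConst n * S + 3 * (ballConst n * twoPow (n + |μ| + 2 + b / 2))

/-- The fixed-time estimate: the norm of `e^{sΔ} F` on `A_j` is bounded by an integrable weight at
the parabolic scale `4 ^ j`. -/
theorem eLpNorm_posHeat_le (hn : n ≠ 0) (hp' : 1 ≤ p') (hp'p : p' ≤ p) (hp'q : p' ≤ q)
    (ha : a = μ + n * (p⁻¹).toReal) (hbdef : b = ν + n * (q⁻¹).toReal) (hb : 0 < b)
    (hab : a = b + 2) (han : a ≤ n) {σ : ℝ}
    (hσ : 2 * σ = n * ((p'⁻¹).toReal - (q⁻¹).toReal)) (hσ1 : σ < 1) {s : ℝ} (hs : 0 < s) (j : ℤ)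
    {F : EuclideanSpace ℝ (Fin n) → ℝ≥0∞} (hF : Measurable F) {M S : ℝ≥0∞}
    (hM : ∀ k : ℤ, twoPow (k * μ) * eLpNorm F p (volume.restrict (annulus n k)) ≤ M)
    (hS : ∑' k : ℤ, twoPow (-min (n - a) (b / 2) * |(k : ℝ) - j|) *
      (twoPow (k * μ) * eLpNorm F p (volume.restrict (annulus n k))) ≤ S * M) :
    twoPow (j * ν) * eLpNorm (posHeat s F) q (volume.restrict (annulus n j)) ≤
      heatConst n μ b S * M * timeWeight σ (1 + b / 4) j s := by
  -- times are written as `4 ^ l`, so that all the bounds compare exponents of `2`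
  obtain ⟨l, rfl⟩ : ∃ l : ℝ, s = (2 : ℝ) ^ (2 * l) :=
    ⟨Real.logb 2 s / 2, by
      rw [mul_div_cancel₀ _ two_ne_zero, Real.rpow_logb two_pos (by norm_num) hs]⟩
  have hq : 1 ≤ q := hp'.trans hp'q
  have hσ0 : 0 ≤ σ := by
    have : 0 ≤ (n : ℝ) * ((p'⁻¹).toReal - (q⁻¹).toReal) :=
      mul_nonneg (by positivity) (sub_nonneg.2 (toReal_inv_le_toReal_inv hp' hp'q))
    linarith
  have hfar := far_sum_le (hp'.trans hp'p) hq ha hbdef hb hab han hσ0 hσ1 j l hF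
  set W := timeWeight σ (1 + b / 4) j ((2 : ℝ) ^ (2 * l))
  set A := ∑' k : ℤ, farConst n * twoPow (-n * max (max (j : ℝ) k) l) *
        eLpNorm F 1 (volume.restrict (annulus n k))
  set π := (volume : Measure (EuclideanSpace ℝ (Fin n))).restrict (annulus n j)
  set G : ℤ → EuclideanSpace ℝ (Fin n) → ℝ≥0∞ := fun k x => ∫⁻ y in annulus n k,
        ENNReal.ofReal (heatKernel ((2 : ℝ) ^ (2 * l)) (x - y)) * F y with hG
  have hGm : ∀ k, Measurable (G k) := fun k =>
    ((measurable_ofReal_heatKernel_sub _).mul (hF.comp measurable_snd)).lintegral_prod_right'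
  have hA : eLpNorm (fun _ : EuclideanSpace ℝ (Fin n) => A) q π ≤
      A * volume (annulus n j) ^ (q⁻¹).toReal := by
    refine (eLpNorm_le_of_ae_enorm_bound (C := A) (by simp)).trans (le_of_eq ?_)
    rw [smul_eq_mul, Measure.restrict_apply_univ, ENNReal.toReal_inv]
  have hnear : twoPow (j * ν) * eLpNorm (fun x => if l < j + 1 then
      ∑ k ∈ Finset.Icc (j - 1) (j + 1), G k x else 0) q π ≤
        3 * (ballConst n * twoPow (n + |μ| + 2 + b / 2) * W * M) := by
    split_ifs with hl
    · have h1 : eLpNorm (fun x => ∑ k ∈ Finset.Icc (j - 1) (j + 1), G k x) q π ≤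
          ∑ k ∈ Finset.Icc (j - 1) (j + 1), eLpNorm (G k) q π := by
        have := eLpNorm_sum_le (s := Finset.Icc (j - 1) (j + 1)) (f := G) (μ := π)
          (fun k _ => (hGm k).aestronglyMeasurable) hq
        refine le_trans (le_of_eq ?_) this
        congr 1; ext x; simp
      calc _ ≤ twoPow (j * ν) * ∑ k ∈ Finset.Icc (j - 1) (j + 1), eLpNorm (G k) q π := by gcongr
        _ ≤ ∑ k ∈ Finset.Icc (j - 1) (j + 1),
            ballConst n * twoPow (n + |μ| + 2 + b / 2) * W * M := by
          rw [Finset.mul_sum]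
          refine Finset.sum_le_sum fun k hk => ?_
          refine (near_le hp' hp'p hp'q ha hbdef hb hab hσ hσ1 hk hl hF).trans ?_
          gcongr
          exact hM k
        _ = _ := by
          rw [Finset.sum_const, Int.card_Icc, nsmul_eq_mul,
            show (j + 1 + 1 - (j - 1)).toNat = 3 by omega]
          rfl
    · simp
  calc twoPow (j * ν) * eLpNorm (posHeat ((2 : ℝ) ^ (2 * l)) F) q π
      ≤ twoPow (j * ν) * eLpNorm ((fun _ => A) + fun x => if l < j + 1 then
          ∑ k ∈ Finset.Icc (j - 1) (j + 1), G k x else 0) q π := by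
        gcongr
        refine eLpNorm_mono_enorm_ae ?_
        filter_upwards [ae_restrict_mem (measurableSet_annulus j)] with x hx
        simp only [enorm_eq_self]
        exact posHeat_le hn l hF hx
    _ ≤ twoPow (j * ν) * (A * volume (annulus n j) ^ (q⁻¹).toReal +
          eLpNorm (fun x => if l < j + 1 then
            ∑ k ∈ Finset.Icc (j - 1) (j + 1), G k x else 0) q π) := by
        gcongr
        refine (eLpNorm_add_le aestronglyMeasurable_const ?_ hq).trans (by gcongr)
        split_ifs
        · exact (Finset.measurable_sum _ fun k _ => hGm k).aestronglyMeasurable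
        · exact aestronglyMeasurable_const
    _ ≤ ballConst n * ballConst n * farConst n * W * (S * M) +
          3 * (ballConst n * twoPow (n + |μ| + 2 + b / 2) * W * M) := by
        rw [mul_add]
        exact add_le_add (hfar.trans (by gcongr)) hnear
    _ = _ := by rw [heatConst]; ring

end FixedTime

/-! ### Sequences -/

section Sequences

theorem tsum_twoPow_ne_top {ε : ℝ} (hε : 0 < ε) : ∑' k : ℤ, twoPow (-ε * |(k : ℝ)|) ≠ ∞ := by
  refine Summable.tsum_ofReal_ne_top ?_
  have h0 : (2 : ℝ) ^ (-ε) < 1 := Real.rpow_lt_one_of_one_lt_of_neg one_lt_two (by linarith)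
  have h : ∀ m : ℕ, (2 : ℝ) ^ (-ε * (m : ℝ)) = ((2 : ℝ) ^ (-ε)) ^ m := fun m => by
    rw [Real.rpow_mul zero_le_two, Real.rpow_natCast]
  refine Summable.of_nat_of_neg ?_ ?_ <;>
  · simp only [Int.cast_neg, Int.cast_natCast, abs_neg, Nat.abs_cast, h]
    exact summable_geometric_of_lt_one (by positivity) h0

theorem tsum_twoPow_sub (ε : ℝ) (j : ℤ) :
    ∑' k : ℤ, twoPow (-ε * |(k : ℝ) - j|) = ∑' k : ℤ, twoPow (-ε * |(k : ℝ)|) := by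
  rw [← (Equiv.subRight j).tsum_eq fun k : ℤ => twoPow (-ε * |(k : ℝ)|)]
  simp

theorem le_tsum_rpow_rpow {ι : Type*} (α : ι → ℝ≥0∞) {r : ℝ} (hr : 0 < r) (k : ι) :
    α k ≤ (∑' i, α i ^ r) ^ (1 / r) := by
  rw [one_div, ENNReal.le_rpow_inv_iff hr]
  exact ENNReal.le_tsum k

/-- The embedding `ℓ^r ⊆ ℓ¹` for `r ≤ 1`. -/
theorem tsum_le_tsum_rpow_rpow {ι : Type*} (α : ι → ℝ≥0∞) {r : ℝ} (hr : 0 < r) (hr1 : r ≤ 1) :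
    ∑' i, α i ≤ (∑' i, α i ^ r) ^ (1 / r) := by
  set S := (∑' i, α i ^ r) ^ (1 / r) with hS
  have hSr : ∑' i, α i ^ r = S ^ r := by
    rw [hS, ← ENNReal.rpow_mul, one_div_mul_cancel hr.ne', ENNReal.rpow_one]
  have h : ∀ (x : ℝ≥0∞), x ^ r * x ^ (1 - r) = x := fun x => by
    rw [← ENNReal.rpow_add_of_nonneg _ _ hr.le (by linarith), add_sub_cancel, ENNReal.rpow_one]
  calc ∑' i, α i ≤ ∑' i, α i ^ r * S ^ (1 - r) := by
        refine ENNReal.tsum_le_tsum fun i => ?_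
        calc α i = α i ^ r * α i ^ (1 - r) := (h _).symm
          _ ≤ _ := by
            gcongr _ * ?_
            exact ENNReal.rpow_le_rpow (le_tsum_rpow_rpow α hr i) (by linarith)
    _ = S := by rw [ENNReal.tsum_mul_right, hSr, h]

end Sequences

/-! ### Herz norms -/

section HerzNorm

variable {𝕜 : Type*} [RCLike 𝕜]

theorem piece_eq (s : ℝ) (q : ℝ≥0∞) (f : EuclideanSpace ℝ (Fin n) → 𝕜) (j : ℤ) :
    piece s q f j = twoPow (j * s) * eLpNorm f q (volume.restrict (annulus n j)) := by
  rw [piece, eLpNorm_indicator_eq_eLpNorm_restrict (measurableSet_annulus j)]; rfl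

theorem piece_le_herzNorm (s : ℝ) (q : ℝ≥0∞) {r : ℝ≥0∞} (hr : 0 < r)
    (f : EuclideanSpace ℝ (Fin n) → 𝕜) (j : ℤ) : piece s q f j ≤ herzNorm s q r f := by
  rw [herzNorm]
  split_ifs with h
  · exact le_iSup _ j
  · exact le_tsum_rpow_rpow (piece s q f) (ENNReal.toReal_pos hr.ne' h) j

theorem tsum_piece_le_herzNorm (s : ℝ) (q : ℝ≥0∞) {r : ℝ≥0∞} (hr : 0 < r) (hr1 : r ≤ 1)
    (f : EuclideanSpace ℝ (Fin n) → 𝕜) : ∑' j, piece s q f j ≤ herzNorm s q r f := by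
  have h : r ≠ ∞ := (hr1.trans_lt ENNReal.one_lt_top).ne
  rw [herzNorm, if_neg h]
  refine tsum_le_tsum_rpow_rpow (piece s q f) (ENNReal.toReal_pos hr.ne' h) ?_
  rw [← ENNReal.toReal_one]
  exact ENNReal.toReal_mono ENNReal.one_ne_top hr1

/-- A weighted sum of the dyadic pieces with weights `2 ^ (-ε |k - j|)` is bounded by the Herz norm,
uniformly in `j`, if `ε > 0` or if `r ≤ 1`. -/
theorem exists_tsum_piece_le (s : ℝ) (q : ℝ≥0∞) {r : ℝ≥0∞} (hr : 0 < r) {ε : ℝ} (hε : 0 ≤ ε)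
    (h : 0 < ε ∨ r ≤ 1) : ∃ S : ℝ≥0∞, S ≠ ∞ ∧
      ∀ (f : EuclideanSpace ℝ (Fin n) → 𝕜) (j : ℤ),
        ∑' k : ℤ, twoPow (-ε * |(k : ℝ) - j|) * piece s q f k ≤ S * herzNorm s q r f := by
  rcases h with h | h
  · refine ⟨_, tsum_twoPow_ne_top h, fun f j => ?_⟩
    rw [← tsum_twoPow_sub ε j, ← ENNReal.tsum_mul_right]
    refine ENNReal.tsum_le_tsum fun k => ?_
    gcongr
    exact piece_le_herzNorm s q hr f k
  · refine ⟨1, ENNReal.one_ne_top, fun f j => ?_⟩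
    rw [one_mul]
    refine le_trans (ENNReal.tsum_le_tsum fun k => ?_) (tsum_piece_le_herzNorm s q hr h f)
    refine mul_le_of_le_one_left zero_le ?_
    rw [← twoPow_zero]
    refine twoPow_mono ?_
    rw [neg_mul, neg_nonpos]
    positivity

end HerzNorm

/-! ### The Duhamel integral -/

section Duhamel

/-- The Duhamel integral of a nonnegative function. -/
def posDuhamel (t : ℝ) (F : ℝ × EuclideanSpace ℝ (Fin n) → ℝ≥0∞) (x : EuclideanSpace ℝ (Fin n)) :
    ℝ≥0∞ :=
  ∫⁻ τ in Ioo 0 t, posHeat (t - τ) (fun y => F (τ, y)) x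

theorem measurable_posHeat_sub (t : ℝ) {F : ℝ × EuclideanSpace ℝ (Fin n) → ℝ≥0∞}
    (hF : Measurable F) : Measurable fun z : ℝ × EuclideanSpace ℝ (Fin n) =>
      posHeat (t - z.1) (fun y => F (z.1, y)) z.2 := by
  have h : Measurable fun w : (ℝ × EuclideanSpace ℝ (Fin n)) × EuclideanSpace ℝ (Fin n) =>
      ENNReal.ofReal (heatKernel (t - w.1.1) (w.1.2 - w.2)) * F (w.1.1, w.2) :=
    ((measurable_heatKernel.comp (((measurable_const.sub measurable_fst.fst)).prodMk
      (measurable_fst.snd.sub measurable_snd))).ennreal_ofReal).mul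
      (hF.comp (measurable_fst.fst.prodMk measurable_snd))
  exact h.lintegral_prod_right'

theorem lintegral_timeWeight_sub_le {σ κ : ℝ} (hσ : σ < 1) (hκ : 1 < κ) (j : ℤ) (t : ℝ) :
    ∫⁻ τ in Ioo (0 : ℝ) t, timeWeight σ κ j (t - τ) ≤
      ENNReal.ofReal (∫ u in Ioi (0 : ℝ), timeProfile σ κ u) := by
  rw [← lintegral_timeWeight hσ hκ j, ← lintegral_indicator measurableSet_Ioi,
    ← lintegral_sub_left_eq_self ((Ioi (0 : ℝ)).indicator (timeWeight σ κ j)) t]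
  refine le_trans ?_ (setLIntegral_le_lintegral (Ioo 0 t) _)
  refine setLIntegral_mono' measurableSet_Ioo fun τ hτ => ?_
  rw [indicator_of_mem (show t - τ ∈ Ioi (0 : ℝ) from sub_pos.2 hτ.2)]

/-- The estimate for the Duhamel integral on one annulus, with a constant independent of the annulus
and of the final time. -/
theorem eLpNorm_posDuhamel_le (hn : n ≠ 0) {μ ν a b : ℝ} {p p' q : ℝ≥0∞} (hp' : 1 ≤ p')
    (hp'p : p' ≤ p) (hp'q : p' ≤ q)
    (ha : a = μ + n * (p⁻¹).toReal) (hbdef : b = ν + n * (q⁻¹).toReal) (hb : 0 < b)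
    (hab : a = b + 2) (han : a ≤ n) {σ : ℝ}
    (hσ : 2 * σ = n * ((p'⁻¹).toReal - (q⁻¹).toReal)) (hσ1 : σ < 1) {t : ℝ} (j : ℤ)
    {F : ℝ × EuclideanSpace ℝ (Fin n) → ℝ≥0∞} (hF : Measurable F) {M S : ℝ≥0∞}
    (hM : ∀ᵐ τ ∂volume.restrict (Ioo 0 t), ∀ k : ℤ,
      twoPow (k * μ) * eLpNorm (fun y => F (τ, y)) p (volume.restrict (annulus n k)) ≤ M)
    (hS : ∀ᵐ τ ∂volume.restrict (Ioo 0 t), ∑' k : ℤ,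
      twoPow (-min (n - a) (b / 2) * |(k : ℝ) - j|) *
      (twoPow (k * μ) * eLpNorm (fun y => F (τ, y)) p (volume.restrict (annulus n k))) ≤ S * M) :
    twoPow (j * ν) * eLpNorm (posDuhamel t F) q (volume.restrict (annulus n j)) ≤
      heatConst n μ b S * ENNReal.ofReal (∫ u in Ioi (0 : ℝ), timeProfile σ (1 + b / 4) u) * M := by
  have hae : ∀ᵐ τ ∂volume.restrict (Ioo (0 : ℝ) t), 0 < t - τ := by
    filter_upwards [ae_restrict_mem measurableSet_Ioo] with τ hτ
    exact sub_pos.2 hτ.2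
  have key : eLpNorm (posDuhamel t F) q (volume.restrict (annulus n j)) ≤
      twoPow (-(j * ν)) * (heatConst n μ b S * M) *
        ∫⁻ τ in Ioo 0 t, timeWeight σ (1 + b / 4) j (t - τ) := by
    refine eLpNorm_lintegral_le (measurable_posHeat_sub t hF)
      ((measurable_timeWeight _ _ j).comp (measurable_const.sub measurable_id))
      (hae.mono fun τ hτ => timeWeight_ne_zero _ _ j hτ)
      (Filter.Eventually.of_forall fun τ => timeWeight_ne_top _ _ _ _) (hp'.trans hp'q) ?_
    filter_upwards [hae, hM, hS] with τ hτ hMτ hSτ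
    have h := eLpNorm_posHeat_le hn hp' hp'p hp'q ha hbdef hb hab han hσ hσ1 hτ j
      (hF.comp measurable_prodMk_left) hMτ hSτ
    rw [mul_assoc]
    refine le_trans (le_of_eq (twoPow_neg_mul_cancel (j * ν) _).symm) ?_
    exact mul_le_mul_right h _
  have hI := lintegral_timeWeight_sub_le hσ1 (by linarith : 1 < 1 + b / 4) j t
  calc _ ≤ twoPow (j * ν) * (twoPow (-(j * ν)) * (heatConst n μ b S * M) *
        ENNReal.ofReal (∫ u in Ioi (0 : ℝ), timeProfile σ (1 + b / 4) u)) := by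
        gcongr
        exact key.trans (by gcongr)
    _ = twoPow (-(j * ν)) * (twoPow (j * ν) * (heatConst n μ b S *
        ENNReal.ofReal (∫ u in Ioi (0 : ℝ), timeProfile σ (1 + b / 4) u) * M)) := by ring
    _ = _ := twoPow_neg_mul_cancel _ _

theorem heatConst_ne_top (n : ℕ) (μ b : ℝ) {S : ℝ≥0∞} (hS : S ≠ ∞) : heatConst n μ b S ≠ ∞ := by
  have h1 := ballConst_ne_top n
  have h2 : farConst n ≠ ∞ := ENNReal.mul_ne_top ENNReal.ofReal_ne_top (twoPow_ne_top _)
  unfold heatConst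
  have h3 := twoPow_ne_top (n + |μ| + 2 + b / 2)
  finiteness

theorem posDuhamel_lt_top_ae (hn : n ≠ 0) {ν : ℝ} {q : ℝ≥0∞} (hq : 1 ≤ q) {t : ℝ}
    {F : ℝ × EuclideanSpace ℝ (Fin n) → ℝ≥0∞} (hF : Measurable F)
    (h : ∀ j : ℤ, twoPow (j * ν) *
      eLpNorm (posDuhamel t F) q (volume.restrict (annulus n j)) < ∞) :
    ∀ᵐ x, posDuhamel t F x < ∞ := by
  have : NeZero n := ⟨hn⟩
  have hUm : Measurable (posDuhamel t F) := (measurable_posHeat_sub t hF).lintegral_prod_left'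
  rw [← restrict_compl_singleton (μ := volume) (0 : EuclideanSpace ℝ (Fin n)), ← iUnion_annulus,
    ae_restrict_iUnion_iff]
  intro j
  have hj : eLpNorm (posDuhamel t F) q (volume.restrict (annulus n j)) < ∞ := by
    rw [← twoPow_neg_mul_cancel (j * ν)
      (eLpNorm (posDuhamel t F) q (volume.restrict (annulus n j)))]
    exact ENNReal.mul_lt_top (twoPow_ne_top _).lt_top (h j)
  -- on an annulus, `L^q` embeds into `L¹`
  have h1 := eLpNorm_annulus_le le_rfl hq j hUm
  rw [eLpNorm_one_eq_lintegral_enorm] at h1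
  refine ae_lt_top hUm (h1.trans_lt ?_).ne
  exact ENNReal.mul_lt_top (ENNReal.mul_lt_top (ballConst_ne_top n).lt_top (twoPow_ne_top _).lt_top)
    hj

variable {𝕜 : Type*} [RCLike 𝕜]

theorem enorm_heatKernel_smul (s : ℝ) (z : EuclideanSpace ℝ (Fin n)) (c : 𝕜) :
    ‖heatKernel s z • c‖ₑ = ENNReal.ofReal (heatKernel s z) * ‖c‖ₑ := by
  rw [enorm_smul, Real.enorm_of_nonneg (heatKernel_nonneg s z)]

theorem stronglyMeasurable_duhamel_integrand (t : ℝ)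
    {g : ℝ × EuclideanSpace ℝ (Fin n) → 𝕜} (hg : StronglyMeasurable g) :
    StronglyMeasurable fun w : (EuclideanSpace ℝ (Fin n) × ℝ) × EuclideanSpace ℝ (Fin n) =>
      heatKernel (t - w.1.2) (w.1.1 - w.2) • g (w.1.2, w.2) :=
  (measurable_heatKernel.comp (((measurable_const.sub measurable_fst.snd)).prodMk
    (measurable_fst.fst.sub measurable_snd))).stronglyMeasurable.smul
      (hg.comp_measurable (measurable_fst.snd.prodMk measurable_snd))

/-- The Duhamel integral does not change when almost every time slice is modified on a null set. -/
theorem duhamel_eq {t : ℝ} (ht : 0 < t) {f g : ℝ → EuclideanSpace ℝ (Fin n) → 𝕜}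
    (hfg : ∀ᵐ τ ∂volume.restrict (Ioo 0 t), f τ =ᵐ[volume] g τ) :
    duhamel t f = fun x => ∫ τ in Ioo 0 t, heatSemigroup (t - τ) (g τ) x := by
  ext x
  rw [duhamel, intervalIntegral.integral_of_le ht.le, integral_Ioc_eq_integral_Ioo]
  refine integral_congr_ae ?_
  filter_upwards [hfg] with τ hτ
  refine integral_congr_ae ?_
  filter_upwards [hτ] with y hy
  rw [hy]

theorem enorm_duhamel_le {t : ℝ} (ht : 0 < t) {f : ℝ → EuclideanSpace ℝ (Fin n) → 𝕜}
    {g : ℝ × EuclideanSpace ℝ (Fin n) → 𝕜}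
    (hfg : ∀ᵐ τ ∂volume.restrict (Ioo 0 t), f τ =ᵐ[volume] fun y => g (τ, y))
    (x : EuclideanSpace ℝ (Fin n)) :
    ‖duhamel t f x‖ₑ ≤ posDuhamel t (fun z => ‖g z‖ₑ) x := by
  rw [duhamel_eq (g := fun τ y => g (τ, y)) ht hfg]
  refine (enorm_integral_le_lintegral_enorm _).trans (lintegral_mono fun τ => ?_)
  refine (enorm_integral_le_lintegral_enorm _).trans (le_of_eq ?_)
  exact lintegral_congr fun y => enorm_heatKernel_smul _ _ _

theorem aestronglyMeasurable_duhamel {t : ℝ} (ht : 0 < t)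
    {f : ℝ → EuclideanSpace ℝ (Fin n) → 𝕜} {g : ℝ × EuclideanSpace ℝ (Fin n) → 𝕜}
    (hg : StronglyMeasurable g)
    (hfg : ∀ᵐ τ ∂volume.restrict (Ioo 0 t), f τ =ᵐ[volume] fun y => g (τ, y)) :
    AEStronglyMeasurable (duhamel t f) volume := by
  rw [duhamel_eq (g := fun τ y => g (τ, y)) ht hfg]
  exact (stronglyMeasurable_duhamel_integrand t
    hg).integral_prod_right'.integral_prod_right'.aestronglyMeasurable

theorem integrable_duhamel_integrand {t : ℝ} {f : ℝ → EuclideanSpace ℝ (Fin n) → 𝕜}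
    {g : ℝ × EuclideanSpace ℝ (Fin n) → 𝕜} (hg : StronglyMeasurable g)
    (hfg : (fun z : ℝ × EuclideanSpace ℝ (Fin n) => f z.1 z.2)
      =ᵐ[(volume.restrict (Ioo 0 t)).prod volume] g) {x : EuclideanSpace ℝ (Fin n)}
    (hx : posDuhamel t (fun z => ‖g z‖ₑ) x < ∞) :
    Integrable (fun z : ℝ × EuclideanSpace ℝ (Fin n) =>
      heatKernel (t - z.1) (x - z.2) • f z.1 z.2) ((volume.restrict (Ioo 0 t)).prod volume) := by
  have hm : StronglyMeasurable fun z : ℝ × EuclideanSpace ℝ (Fin n) =>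
      heatKernel (t - z.1) (x - z.2) • g z :=
    (stronglyMeasurable_duhamel_integrand t hg).comp_measurable
      ((measurable_const.prodMk measurable_fst).prodMk measurable_snd)
  have hi : Integrable (fun z : ℝ × EuclideanSpace ℝ (Fin n) =>
      heatKernel (t - z.1) (x - z.2) • g z) ((volume.restrict (Ioo 0 t)).prod volume) := by
    refine ⟨hm.aestronglyMeasurable, ?_⟩
    rw [hasFiniteIntegral_iff_enorm, lintegral_prod _ hm.enorm.aemeasurable]
    simp_rw [enorm_heatKernel_smul]
    exact hx
  refine hi.congr ?_
  filter_upwards [hfg] with z hz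
  rw [hz]

end Duhamel

/-! ### The estimate on Herz spaces -/

/-- The exponent `p' = min p q` for which the local `L^{p'} → L^q` smoothing estimate is integrable
in time near `0`. -/
theorem exists_local_exponent {n : ℕ} {μ ν : ℝ} {p q : ℝ≥0∞} (hp : 1 ≤ p) (hq : 1 ≤ q)
    (hμν : ν < μ)
    (h : μ + n * (p⁻¹).toReal = ν + n * (q⁻¹).toReal + 2) :
    ∃ p' : ℝ≥0∞, 1 ≤ p' ∧ p' ≤ p ∧ p' ≤ q ∧
      (n : ℝ) * ((p'⁻¹).toReal - (q⁻¹).toReal) < 2 := by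
  rcases le_total p q with hpq | hpq
  · exact ⟨p, hp, le_rfl, hpq, by linarith⟩
  · exact ⟨q, hq, hpq, le_rfl, by simp⟩

end Herz

end

theorem proposition3p2 {𝕜 : Type*} [RCLike 𝕜] (n : ℕ) (hn : 3 ≤ n)
    (μ ν : ℝ) (p q r : ℝ≥0∞) (hp : 1 ≤ p) (hq : 1 ≤ q) (hr : 0 < r)
    (hμν : ν < μ)
    (h_pos : 0 < ν / n + (q⁻¹).toReal)
    (h_lt : ν / n + (q⁻¹).toReal < μ / n + (p⁻¹).toReal)
    (h_le : μ / n + (p⁻¹).toReal ≤ 1)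
    (h_scale : ν / n + (q⁻¹).toReal = (μ / n + (p⁻¹).toReal) - 2 / n)
    (h_cases : (p < ∞ ∧ q < ∞ ∧ μ / n + (p⁻¹).toReal < 1) ∨ r ≤ 1) :
    ∃ C : ℝ≥0, ∀ t : ℝ, 0 < t → ∀ f : ℝ → EuclideanSpace ℝ (Fin n) → 𝕜,
      AEStronglyMeasurable (fun z : ℝ × EuclideanSpace ℝ (Fin n) => f z.1 z.2)
        ((volume.restrict (Ioo 0 t)).prod volume) →
      (∀ τ ∈ Ioo 0 t, Herz.MemHerz μ p r (f τ)) →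
      (⨆ τ ∈ Ioo 0 t, Herz.herzNorm μ p r (f τ)) < ∞ →
        -- the Duhamel integral converges absolutely at almost every point
        (∀ᵐ x : EuclideanSpace ℝ (Fin n),
          Integrable (fun z : ℝ × EuclideanSpace ℝ (Fin n) =>
              Herz.heatKernel (t - z.1) (x - z.2) • f z.1 z.2)
            ((volume.restrict (Ioo 0 t)).prod volume)) ∧
        Herz.MemHerz ν q ∞ (Herz.duhamel t f) ∧
        Herz.herzNorm ν q ∞ (Herz.duhamel t f) ≤
          C * ⨆ τ ∈ Ioo 0 t, Herz.herzNorm μ p r (f τ) := by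
  have hn0 : n ≠ 0 := by omega
  have hnr : (0 : ℝ) < n := by positivity
  obtain ⟨a, ha⟩ : ∃ a, a = μ + n * (p⁻¹).toReal := ⟨_, rfl⟩
  obtain ⟨b, hbdef⟩ : ∃ b, b = ν + n * (q⁻¹).toReal := ⟨_, rfl⟩
  have ha' : μ / n + (p⁻¹).toReal = a / n := by rw [ha]; field_simp
  have hb' : ν / n + (q⁻¹).toReal = b / n := by rw [hbdef]; field_simp
  rw [ha'] at h_le h_scale h_cases
  rw [hb'] at h_pos h_scale
  have hb : 0 < b := by rwa [div_pos_iff_of_pos_right hnr] at h_pos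
  have han : a ≤ n := by rwa [div_le_one hnr] at h_le
  have hab : a = b + 2 := by
    rw [← sub_div, div_left_inj' hnr.ne'] at h_scale
    linarith
  obtain ⟨p', hp', hp'p, hp'q, hlt⟩ := Herz.exists_local_exponent hp hq hμν
    (by rw [← ha, ← hbdef, hab] : μ + n * (p⁻¹).toReal = ν + n * (q⁻¹).toReal + 2)
  obtain ⟨σ, hσ⟩ : ∃ σ : ℝ, 2 * σ = n * ((p'⁻¹).toReal - (q⁻¹).toReal) :=
    ⟨_, mul_div_cancel₀ _ two_ne_zero⟩
  have hσ1 : σ < 1 := by linarith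
  have hε : 0 < min ((n : ℝ) - a) (b / 2) ∨ r ≤ 1 := by
    refine h_cases.imp (fun h => lt_min ?_ (by positivity)) id
    have := (div_lt_one hnr).1 h.2.2
    linarith
  obtain ⟨S, hS, hSsum⟩ := Herz.exists_tsum_piece_le (n := n) (𝕜 := 𝕜) μ p hr
    (le_min (sub_nonneg.2 han) (by positivity) : 0 ≤ min ((n : ℝ) - a) (b / 2)) hε
  set K : ℝ≥0∞ := Herz.heatConst n μ b S *
    ENNReal.ofReal (∫ u in Ioi (0 : ℝ), Herz.timeProfile σ (1 + b / 4) u) with hK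
  have hKt : K ≠ ∞ := ENNReal.mul_ne_top (Herz.heatConst_ne_top n μ b hS) ENNReal.ofReal_ne_top
  refine ⟨K.toNNReal, fun t ht f hf _ hM => ?_⟩
  rw [ENNReal.coe_toNNReal hKt]
  set M := ⨆ τ ∈ Ioo 0 t, Herz.herzNorm μ p r (f τ) with hMdef
  -- a jointly measurable modification of `f`, which agrees with `f` on almost every time slice
  obtain ⟨g, hg, hfg⟩ := hf
  have hslice : ∀ᵐ τ ∂volume.restrict (Ioo 0 t), f τ =ᵐ[volume] fun y => g (τ, y) :=
    Measure.ae_ae_of_ae_prod hfg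
  have hnorm : ∀ᵐ τ ∂volume.restrict (Ioo 0 t), Herz.herzNorm μ p r (f τ) ≤ M := by
    filter_upwards [ae_restrict_mem measurableSet_Ioo] with τ hτ
    exact le_iSup₂ (f := fun τ (_ : τ ∈ Ioo 0 t) => Herz.herzNorm μ p r (f τ)) τ hτ
  have hpiece : ∀ᵐ τ ∂volume.restrict (Ioo 0 t), ∀ k : ℤ,
      Herz.twoPow (k * μ) * eLpNorm (fun y => ‖g (τ, y)‖ₑ) p
        (volume.restrict (Herz.annulus n k)) = Herz.piece μ p (f τ) k := by
    filter_upwards [hslice] with τ hτ k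
    rw [Herz.piece_eq, eLpNorm_enorm, eLpNorm_congr_ae (ae_restrict_of_ae hτ)]
  have hmain : ∀ j : ℤ, Herz.twoPow (j * ν) *
      eLpNorm (Herz.posDuhamel t fun z => ‖g z‖ₑ) q (volume.restrict (Herz.annulus n j)) ≤
        K * M := by
    intro j
    refine Herz.eLpNorm_posDuhamel_le hn0 hp' hp'p hp'q ha hbdef hb hab han hσ hσ1 j hg.enorm ?_ ?_
    · filter_upwards [hpiece, hnorm] with τ hτ hMτ k
      rw [hτ]
      exact (Herz.piece_le_herzNorm μ p hr _ k).trans hMτ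
    · filter_upwards [hpiece, hnorm] with τ hτ hMτ
      simp only [hτ]
      exact (hSsum (f τ) j).trans (by gcongr)
  have hKM : K * M < ∞ := ENNReal.mul_lt_top hKt.lt_top hM
  have hbound : Herz.herzNorm ν q ∞ (Herz.duhamel t f) ≤ K * M := by
    rw [Herz.herzNorm, if_pos rfl]
    refine iSup_le fun j => ?_
    rw [Herz.piece_eq]
    refine le_trans (mul_le_mul_right (eLpNorm_mono_enorm fun x => ?_) _) (hmain j)
    rw [enorm_eq_self]
    exact Herz.enorm_duhamel_le ht hslice x
  refine ⟨?_, ⟨Herz.aestronglyMeasurable_duhamel ht hg hslice, hbound.trans_lt hKM⟩, hbound⟩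
  filter_upwards [Herz.posDuhamel_lt_top_ae hn0 hq hg.enorm
    fun j => (hmain j).trans_lt hKM] with x hx
  exact Herz.integrable_duhamel_integrand hg hfg hx
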